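/- Let $V:\mathbb R^d\to\mathbb R^d$ and let $x^*$ be an isolated solution of $V(x)=0$ (i.e. $V(x^*)=0$ and $V\neq 0$ at all other points near $x^*$). Assume that: 1. $V$ is $L$-Lipschitz continuous in a neighbourhood of $x^*$; 2. $\langle V(x),x-x^*\rangle\ge 0$ for all $x$ near $x^*$; 3. $V$ is differentiable at $x^*$ and its Jacobian matrix there is invertible. Fix $r>0$, $p>3$, $\sigma,\kappa\ge 0$ (noise parameters), a tolerance level $\delta\in(0,1)$, a neighbourhood $W$ of $x^*$ and $\gamma>0$. For $\eta,b>0$ consider the double stepsize extragradient method (DSEG) $$X_{t+1/2}=X_t-\gamma_t\,(V(X_t)+Z_t),\qquad X_{t+1}=X_t-\eta_t\,(V(X_{t+1/2})+Z_{t+1/2}),\qquad t=1,2,\dots,$$ with $\gamma_t=\gamma/(t+b)^{1/3}$ and $\eta_t=\eta/(t+b)^{2/3}$, where the $X_s$ and $Z_s$ ($s=1,\tfrac32,2,\dots$) are random vectors in $\mathbb R^d$ on a common probability space and, with $\mathcal F_s=\sigma(X_1,X_{3/2},\dots,X_s)$ the natural filtration, the noise satisfies for every $s=1,\tfrac32,2,\dots$,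 almost surely, $$\mathbb E[Z_s\mid\mathcal F_s]\,\mathbf 1_{\{\|X_s-x^*\|<r\}}=0,\qquad \mathbb E[\|Z_s\|^p\mid\mathcal F_s]\,\mathbf 1_{\{\|X_s-x^*\|<r\}}\le(\sigma+\kappa\|X_s-x^*\|)^p .$$ Then for all sufficiently large $\eta$ and, given $\eta$, all sufficiently large $b$, there exist open neighbourhoods $U$ and $U'\subseteq W$ of $x^*$ such that for every such run of DSEG with $\mathbb P(X_1\in U)>0$ there is an event $E$ with a) $\mathbb P(E\mid X_1\in U)\ge 1-\delta$; b) $\mathbb P(X_t\in U'\text{ for all }t=1,2,\dots\mid E)=1$; c) $\mathbb E[\|X_t-x^*\|^2\mid E]$ is finite for every $t\geq 1$, and $\mathbb E[\|X_t-x^*\|^2\mid E]=O(1/t^{1/3})$ as $t\to\infty$. Here the thresholds for $\eta$ and $b$ and the neighbourhoods $U,U'$ do not depend on the run. -/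

import Mathlib

open MeasureTheory ProbabilityTheory Filter Topology Asymptotics
open scoped NNReal ENNReal

/-- `x` is an isolated zero of the field `V`. -/
def IsIsolatedSolution {d : ℕ}
    (V : EuclideanSpace ℝ (Fin d) → EuclideanSpace ℝ (Fin d))
    (x : EuclideanSpace ℝ (Fin d)) : Prop :=
  V x = 0 ∧ ∀ᶠ y in 𝓝[≠] x, V y ≠ 0

/-- `V` is `L`-Lipschitz continuous near `x`. -/
def LipschitzNear {d : ℕ} (L : ℝ≥0)
    (V : EuclideanSpace ℝ (Fin d) → EuclideanSpace ℝ (Fin d))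
    (x : EuclideanSpace ℝ (Fin d)) : Prop :=
  ∃ s ∈ 𝓝 x, LipschitzOnWith L V s

/-- Local variational stability: `⟨V y, y - x⟩ ≥ 0` for all `y` near `x`. -/
def StableNear {d : ℕ}
    (V : EuclideanSpace ℝ (Fin d) → EuclideanSpace ℝ (Fin d))
    (x : EuclideanSpace ℝ (Fin d)) : Prop :=
  ∀ᶠ y in 𝓝 x, 0 ≤ inner ℝ (V y) (y - x)

/-- `V` is differentiable at `x` with invertible Jacobian. -/
def RegularJacobian {d : ℕ}
    (V : EuclideanSpace ℝ (Fin d) → EuclideanSpace ℝ (Fin d))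
    (x : EuclideanSpace ℝ (Fin d)) : Prop :=
  DifferentiableAt ℝ V x ∧ (fderiv ℝ V x).IsInvertible

/-- Exploration stepsize `γ_t = γ / (t + b)^(1/3)`. -/
noncomputable def explorationStep (γ b : ℝ) (t : ℕ) : ℝ :=
  γ / ((t : ℝ) + b) ^ (1 / 3 : ℝ)

/-- Update stepsize `η_t = η / (t + b)^(2/3)`. -/
noncomputable def updateStep (η b : ℝ) (t : ℕ) : ℝ :=
  η / ((t : ℝ) + b) ^ (2 / 3 : ℝ)

/-- The history generated by `X_1, X_{3/2}, X_2, …, X_{t-1/2}, X_t`, where `X s` is the base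
state `X_s` and `Xh s` is the leading state `X_{s+1/2}`. -/
abbrev baseHistory {d : ℕ} {Ω : Type*} (X Xh : ℕ → Ω → EuclideanSpace ℝ (Fin d)) (t : ℕ) :
    MeasurableSpace Ω :=
  (⨆ s ∈ Set.Icc 1 t, MeasurableSpace.comap (X s) inferInstance) ⊔
    (⨆ s ∈ Set.Ico 1 t, MeasurableSpace.comap (Xh s) inferInstance)

/-- The history generated by `X_1, X_{3/2}, X_2, …, X_t, X_{t+1/2}`. -/
abbrev leadHistory {d : ℕ} {Ω : Type*} (X Xh : ℕ → Ω → EuclideanSpace ℝ (Fin d)) (t : ℕ) :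
    MeasurableSpace Ω :=
  (⨆ s ∈ Set.Icc 1 t, MeasurableSpace.comap (X s) inferInstance) ⊔
    (⨆ s ∈ Set.Icc 1 t, MeasurableSpace.comap (Xh s) inferInstance)

/-- Local oracle noise condition for one oracle call. The oracle is called at the random point `Y`,
its noise is `Z`, and `m` is the history up to and including `Y`. On the event `Y ∈ ball x r`
the noise has conditional mean zero and conditional `p`-th moment at most `(σ + κ ‖Y - x‖)^p`.
Since `Y` is `m`-measurable, the indicator of this event may be put inside the conditional
expectation, which makes sense of it when the noise is not integrable outside the event.
The field `integrable` follows from the moment bound, as `(σ + κ ‖Y - x‖)^p` is bounded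
on the event; it is there because Mathlib's conditional expectation of a function that is not
integrable is zero by convention. -/
structure LocalNoise {d : ℕ} {Ω : Type*} {mΩ : MeasurableSpace Ω} (μ : Measure Ω)
    (x : EuclideanSpace ℝ (Fin d)) (r p σ κ : ℝ) (m : MeasurableSpace Ω)
    (Y Z : Ω → EuclideanSpace ℝ (Fin d)) : Prop where
  integrable : Integrable ({ω | Y ω ∈ Metric.ball x r}.indicator (fun ω => ‖Z ω‖ ^ p)) μ
  zero_mean : μ[{ω | Y ω ∈ Metric.ball x r}.indicator Z | m] =ᵐ[μ] 0
  moment : μ[{ω | Y ω ∈ Metric.ball x r}.indicator (fun ω => ‖Z ω‖ ^ p) | m]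
    ≤ᵐ[μ] fun ω => (σ + κ * ‖Y ω - x‖) ^ p

/-- A run of the double stepsize extragradient method with stepsizes `γ t`, `η t`, `t = 1, 2, …`.
`X t` is the base state `X_t`, `Xh t` is the leading state `X_{t+1/2}`, and `Z t`, `Zh t` are the
noises of the oracle calls at `X t` and `Xh t`. Index `0` is not used. -/
structure IsDSEG {d : ℕ} {Ω : Type*} [MeasurableSpace Ω]
    (V : EuclideanSpace ℝ (Fin d) → EuclideanSpace ℝ (Fin d)) (γ η : ℕ → ℝ)
    (X Xh Z Zh : ℕ → Ω → EuclideanSpace ℝ (Fin d)) : Prop where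
  measurable_X : ∀ t, 1 ≤ t → Measurable (X t)
  measurable_Xh : ∀ t, 1 ≤ t → Measurable (Xh t)
  measurable_Z : ∀ t, 1 ≤ t → Measurable (Z t)
  measurable_Zh : ∀ t, 1 ≤ t → Measurable (Zh t)
  explore : ∀ t, 1 ≤ t → ∀ ω, Xh t ω = X t ω - γ t • (V (X t ω) + Z t ω)
  update : ∀ t, 1 ≤ t → ∀ ω, X (t + 1) ω = X t ω - η t • (V (Xh t ω) + Zh t ω)

/-! Everything is localized to the events `E_t` (`stayEvent`) on which the run has not yet left
small balls around `x`. There the field is Lipschitz and stable, and invertibility of the Jacobian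
gives `‖V y‖ ≥ τ ‖y - x‖` (`exists_regularOnBall`).

Rate. The exploration half-step turns mere stability into contraction: up to a mean-zero term and an
error of order `γ_t ^ 2`, `⟨V X_{t+1/2}, X_t - x⟩` is at least `γ_t τ² ‖X_t - x‖²`. Since `γ_t η_t =
γ η / (t + b)`, while `η_t γ_t²` and `η_t²` are of order `(t + b) ^ (-4/3)`, the restricted moment
`a_t = E[‖X_t - x‖²; E_t]` satisfies `a_{t+1} ≤ (1 - 2/(t+b)) a_t + K (t+b) ^ (-4/3)` once `η γ τ² ≥
1`. Hence `a_t = O(t ^ (-1/3))` (`le_mul_rpow_of_recursion`).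

Survival. A leading state escapes with probability of order `γ_t ^ p`, summable because `p > 3`. The
escape of a base state is charged to the second moment by Chebyshev, so `P(E_t) - a_t / (ρ/2)²`
loses only a summable amount per step (`stayEvent_step`). Large `b` makes the total loss small. The
required event is the intersection of all `E_t`.

The delicate point is that keeping the leading state in its ball is not decided by the history at
`X_t`, so the noise there is not centred on that event; `RegularOnBall.inner_noise_le` repairs this.
-/

lemma sq_le_one_add_rpow {a p : ℝ} (ha : 0 ≤ a) (hp : 2 ≤ p) : a ^ 2 ≤ 1 + a ^ p := by
  have h0 : 0 ≤ a ^ p := Real.rpow_nonneg ha p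
  rcases le_total a 1 with h | h
  · nlinarith
  · have : a ^ (2 : ℝ) ≤ a ^ p := Real.rpow_le_rpow_of_exponent_le h hp
    rw [Real.rpow_two] at this
    linarith

/-! ### Noise integrals over events of the history -/

namespace LocalNoise

variable {d : ℕ} {Ω : Type*} {m mΩ : MeasurableSpace Ω} {μ : Measure Ω}
  {x : EuclideanSpace ℝ (Fin d)} {r p σ κ ρ : ℝ}
  {Y Z : Ω → EuclideanSpace ℝ (Fin d)} {A : Set Ω}

lemma integrableOn_rpow (h : LocalNoise μ x r p σ κ m Y Z) (hm : m ≤ mΩ)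
    (hA : MeasurableSet[m] A) (hAY : ∀ ω ∈ A, Y ω ∈ Metric.ball x r) :
    IntegrableOn (fun ω => ‖Z ω‖ ^ p) A μ :=
  h.integrable.integrableOn.congr_fun (fun ω hω =>
    Set.indicator_of_mem (show ω ∈ {ω | Y ω ∈ Metric.ball x r} from hAY ω hω) _) (hm _ hA)

variable [IsProbabilityMeasure μ]

lemma setIntegral_rpow_le (h : LocalNoise μ x r p σ κ m Y Z) (hm : m ≤ mΩ)
    (hp : 0 ≤ p) (hσ : 0 ≤ σ) (hκ : 0 ≤ κ) (hρ : ρ ≤ r)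
    (hA : MeasurableSet[m] A) (hAY : ∀ ω ∈ A, Y ω ∈ Metric.ball x ρ) :
    ∫ ω in A, ‖Z ω‖ ^ p ∂μ ≤ (σ + κ * ρ) ^ p * μ.real A := by
  have hAr : ∀ ω ∈ A, Y ω ∈ Metric.ball x r := fun ω hω => Metric.ball_subset_ball hρ (hAY ω hω)
  calc ∫ ω in A, ‖Z ω‖ ^ p ∂μ
      = ∫ ω in A, {ω | Y ω ∈ Metric.ball x r}.indicator (fun ω => ‖Z ω‖ ^ p) ω ∂μ :=
        setIntegral_congr_fun (hm _ hA) fun ω hω =>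
          (Set.indicator_of_mem (show ω ∈ {ω | Y ω ∈ Metric.ball x r} from hAr ω hω) (fun ω => ‖Z ω‖ ^ p)).symm
    _ = ∫ ω in A, (μ[{ω | Y ω ∈ Metric.ball x r}.indicator (fun ω => ‖Z ω‖ ^ p) | m]) ω ∂μ :=
        (setIntegral_condExp hm h.integrable hA).symm
    _ ≤ ∫ _ in A, (σ + κ * ρ) ^ p ∂μ := by
        refine setIntegral_mono_on_ae integrable_condExp.integrableOn
          (integrable_const _).integrableOn (hm _ hA) ?_
        filter_upwards [h.moment] with ω hω hωA
        refine hω.trans (Real.rpow_le_rpow (by positivity) ?_ hp)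
        have := hAY ω hωA
        rw [mem_ball_iff_norm] at this
        gcongr
    _ = (σ + κ * ρ) ^ p * μ.real A := by rw [setIntegral_const, smul_eq_mul, mul_comm]

lemma integrableOn_sq (h : LocalNoise μ x r p σ κ m Y Z) (hm : m ≤ mΩ) (hZ : Measurable Z)
    (hp : 2 ≤ p) (hA : MeasurableSet[m] A) (hAY : ∀ ω ∈ A, Y ω ∈ Metric.ball x r) :
    IntegrableOn (fun ω => ‖Z ω‖ ^ 2) A μ := by
  refine Integrable.mono' ((integrable_const (1 : ℝ)).integrableOn.add
    (h.integrableOn_rpow hm hA hAY)) (hZ.norm.pow_const 2).aestronglyMeasurable (ae_of_all _ fun ω => ?_)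
  rw [Real.norm_of_nonneg (by positivity)]
  exact sq_le_one_add_rpow (norm_nonneg _) hp

/-- The elementary bound `a² ≤ 1 + a ^ p` replaces Jensen's inequality, since the size of the
constant is immaterial. -/
lemma setIntegral_sq_le (h : LocalNoise μ x r p σ κ m Y Z) (hm : m ≤ mΩ) (hZ : Measurable Z)
    (hp : 2 ≤ p) (hσ : 0 ≤ σ) (hκ : 0 ≤ κ) (hρ : ρ ≤ r)
    (hA : MeasurableSet[m] A) (hAY : ∀ ω ∈ A, Y ω ∈ Metric.ball x ρ) :
    ∫ ω in A, ‖Z ω‖ ^ 2 ∂μ ≤ (1 + (σ + κ * ρ) ^ p) * μ.real A := by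
  have hAr : ∀ ω ∈ A, Y ω ∈ Metric.ball x r := fun ω hω => Metric.ball_subset_ball hρ (hAY ω hω)
  have hi := h.integrableOn_rpow hm hA hAr
  have hc : IntegrableOn (fun _ => (1 : ℝ)) A μ := (integrable_const (1 : ℝ)).integrableOn
  calc ∫ ω in A, ‖Z ω‖ ^ 2 ∂μ ≤ ∫ ω in A, (1 + ‖Z ω‖ ^ p) ∂μ :=
        setIntegral_mono (h.integrableOn_sq hm hZ hp hA hAr) (hc.add hi)
          fun ω => sq_le_one_add_rpow (norm_nonneg _) hp
    _ = μ.real A + ∫ ω in A, ‖Z ω‖ ^ p ∂μ := by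
        rw [integral_add hc hi, setIntegral_const, smul_eq_mul, mul_one]
    _ ≤ _ := by
        linarith [h.setIntegral_rpow_le hm (by linarith) hσ hκ hρ hA hAY]

lemma integrable_indicator (h : LocalNoise μ x r p σ κ m Y Z) (hm : m ≤ mΩ) (hZ : Measurable Z)
    (hp : 2 ≤ p) (hY : Measurable[m] Y) :
    Integrable ({ω | Y ω ∈ Metric.ball x r}.indicator Z) μ := by
  have hA : MeasurableSet[m] {ω | Y ω ∈ Metric.ball x r} := hY measurableSet_ball
  rw [integrable_indicator_iff (hm _ hA)]
  refine Integrable.mono' ((integrable_const (1 : ℝ)).integrableOn.add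
    (h.integrableOn_sq hm hZ hp hA fun ω hω => hω)) hZ.aestronglyMeasurable
    (ae_of_all _ fun ω => ?_)
  simp only [Pi.add_apply]
  nlinarith [norm_nonneg (Z ω)]

/-- A factor known from the history can be pulled out of the conditional expectation, which then
vanishes. Truncating `w` to `A` makes it bounded everywhere, and on `A` the localized noise is `Z`
itself. -/
lemma integrableOn_inner_and_setIntegral_eq_zero (h : LocalNoise μ x r p σ κ m Y Z) (hm : m ≤ mΩ)
    (hZ : Measurable Z) (hp : 2 ≤ p) (hY : Measurable[m] Y)
    (hA : MeasurableSet[m] A) (hAY : ∀ ω ∈ A, Y ω ∈ Metric.ball x r)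
    {w : Ω → EuclideanSpace ℝ (Fin d)} (hw : Measurable[m] w) {C : ℝ} (hC : 0 ≤ C)
    (hwC : ∀ ω ∈ A, ‖w ω‖ ≤ C) :
    IntegrableOn (fun ω => inner ℝ (w ω) (Z ω)) A μ ∧ ∫ ω in A, inner ℝ (w ω) (Z ω) ∂μ = 0 := by
  set G := {ω | Y ω ∈ Metric.ball x r}.indicator Z
  have hG : Integrable G μ := h.integrable_indicator hm hZ hp hY
  have hwA : StronglyMeasurable[m] (A.indicator w) := (hw.indicator hA).stronglyMeasurable
  have hbound : ∀ ω, ‖A.indicator w ω‖ ≤ C := fun ω => by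
    by_cases hω : ω ∈ A
    · rw [Set.indicator_of_mem hω]; exact hwC ω hω
    · rw [Set.indicator_of_notMem hω, norm_zero]; exact hC
  have hpull := condExp_stronglyMeasurable_bilin_of_bound (μ := μ)
    (innerSL ℝ (E := EuclideanSpace ℝ (Fin d))) hm hwA hG C (ae_of_all _ hbound)
  have hzero : μ[fun ω => inner ℝ (A.indicator w ω) (G ω) | m] =ᵐ[μ] 0 := by
    refine EventuallyEq.trans hpull ?_
    filter_upwards [h.zero_mean] with ω hω
    rw [hω]
    simp
  have heq : ∀ ω ∈ A, inner ℝ (A.indicator w ω) (G ω) = inner ℝ (w ω) (Z ω) := fun ω hω => by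
    rw [Set.indicator_of_mem hω,
      show G ω = Z ω from Set.indicator_of_mem (s := {ω | Y ω ∈ Metric.ball x r}) (hAY ω hω) _]
  have hint : Integrable (fun ω => inner ℝ (A.indicator w ω) (G ω)) μ := by
    refine Integrable.mono' (hG.norm.const_mul C)
      ((hwA.mono hm).aestronglyMeasurable.inner hG.aestronglyMeasurable) (ae_of_all _ fun ω => ?_)
    exact (norm_inner_le_norm _ _).trans (mul_le_mul_of_nonneg_right (hbound ω) (norm_nonneg _))
  refine ⟨hint.integrableOn.congr_fun heq (hm _ hA), ?_⟩
  rw [← setIntegral_congr_fun (hm _ hA) heq, ← setIntegral_condExp hm hint hA,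
    setIntegral_congr_ae (g := fun _ => (0 : ℝ)) (hm _ hA)
      (hzero.mono fun ω hω _ => hω), integral_zero]

end LocalNoise

/-! ### Pointwise estimates for the field -/

/-- Quantitative regularity of a field around a zero `x`: on the ball of radius `ρ` the field is
`L`-Lipschitz, variationally stable, and grows at least linearly with rate `τ`. -/
structure RegularOnBall {d : ℕ} (V : EuclideanSpace ℝ (Fin d) → EuclideanSpace ℝ (Fin d))
    (x : EuclideanSpace ℝ (Fin d)) (L τ ρ : ℝ) : Prop where
  L_nonneg : 0 ≤ L
  τ_nonneg : 0 ≤ τ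
  ρ_pos : 0 < ρ
  zero : V x = 0
  lip : ∀ y ∈ Metric.ball x ρ, ∀ y' ∈ Metric.ball x ρ, ‖V y - V y'‖ ≤ L * ‖y - y'‖
  stable : ∀ y ∈ Metric.ball x ρ, 0 ≤ inner ℝ (V y) (y - x)
  growth : ∀ y ∈ Metric.ball x ρ, τ * ‖y - x‖ ≤ ‖V y‖

/-- The constant in the one-step estimates of the extragradient method; `L * ρ` bounds the field
and `S` bounds the second and the `p`-th moment of the noise. -/
noncomputable def stepConst (L ρ S : ℝ) : ℝ :=
  (4 * L + 4 * (L * ρ) / ρ) * ((L * ρ) ^ 2 + 1) * (1 + S) + 2 * (L * ρ) ^ 2 + 2 * S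

lemma stepConst_nonneg {L ρ S : ℝ} (hL : 0 ≤ L) (hρ : 0 ≤ ρ) (hS : 0 ≤ S) :
    0 ≤ stepConst L ρ S := by
  unfold stepConst
  positivity

namespace RegularOnBall

variable {d : ℕ} {V : EuclideanSpace ℝ (Fin d) → EuclideanSpace ℝ (Fin d)}
  {x y y' z : EuclideanSpace ℝ (Fin d)} {L τ ρ g : ℝ}

lemma norm_le (h : RegularOnBall V x L τ ρ) (hy : y ∈ Metric.ball x ρ) : ‖V y‖ ≤ L * ρ := by
  have h1 := h.lip y hy x (Metric.mem_ball_self h.ρ_pos)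
  rw [h.zero, sub_zero] at h1
  rw [mem_ball_iff_norm] at hy
  exact h1.trans (mul_le_mul_of_nonneg_left hy.le h.L_nonneg)

lemma norm_add_sq_le (h : RegularOnBall V x L τ ρ) (hy : y ∈ Metric.ball x ρ)
    (z : EuclideanSpace ℝ (Fin d)) : ‖V y + z‖ ^ 2 ≤ 2 * (L * ρ) ^ 2 + 2 * ‖z‖ ^ 2 := by
  have h1 := norm_add_le (V y) z
  have h2 := h.norm_le hy
  have h3 : ‖V y + z‖ ≤ L * ρ + ‖z‖ := by linarith
  have h4 : ‖V y + z‖ ^ 2 ≤ (L * ρ + ‖z‖) ^ 2 := by gcongr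
  nlinarith [sq_nonneg (L * ρ - ‖z‖)]

/-- Write `y - x = (y' - x) + g • (V y + z)`. The first part contributes a nonnegative term by
stability; in the second, replacing `V y'` by `V y` costs `L g ‖V y + z‖²` and leaves `‖V y‖²`,
which the growth bound controls. The summand `2 * (L * ρ) / ρ` of the constant is slack here, so
that `inner_noise_le` can share the constant. -/
lemma inner_lead_ge (h : RegularOnBall V x L τ ρ) (hg : 0 ≤ g)
    (hy : y ∈ Metric.ball x ρ) (hy' : y' ∈ Metric.ball x ρ) (hstep : y' = y - g • (V y + z)) :
    g * (τ ^ 2 * ‖y - x‖ ^ 2 + inner ℝ (V y) z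
      - (2 * L + 2 * (L * ρ) / ρ) * ((L * ρ) ^ 2 + 1) * g * (1 + ‖z‖ ^ 2))
      ≤ inner ℝ (V y') (y - x) := by
  have hρ := h.ρ_pos
  have hL := h.L_nonneg
  have e1 : y - x = (y' - x) + g • (V y + z) := by rw [hstep]; abel
  have e2 : inner ℝ (V y') (y - x) = inner ℝ (V y') (y' - x) + g * inner ℝ (V y') (V y + z) := by
    rw [e1, inner_add_right, real_inner_smul_right]
  have h1 : inner ℝ (V y') (V y + z)
      = ‖V y‖ ^ 2 + inner ℝ (V y) z + inner ℝ (V y' - V y) (V y + z) := by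
    rw [inner_sub_left, inner_add_right (V y), real_inner_self_eq_norm_sq]; ring
  have h2 : ‖V y' - V y‖ ≤ L * (g * ‖V y + z‖) := by
    refine (h.lip _ hy' _ hy).trans_eq ?_
    rw [hstep, sub_sub_cancel_left, norm_neg, norm_smul, Real.norm_of_nonneg hg]
  have h3 : -(L * g * ‖V y + z‖ ^ 2) ≤ inner ℝ (V y' - V y) (V y + z) := by
    have := (abs_le.1 (abs_real_inner_le_norm (V y' - V y) (V y + z))).1
    have := mul_le_mul_of_nonneg_right h2 (norm_nonneg (V y + z))
    nlinarith
  have h4 : τ ^ 2 * ‖y - x‖ ^ 2 ≤ ‖V y‖ ^ 2 := by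
    rw [← mul_pow]
    exact pow_le_pow_left₀ (mul_nonneg h.τ_nonneg (norm_nonneg _)) (h.growth y hy) 2
  have h5 := h.norm_add_sq_le hy z
  have h6 : L * ‖V y + z‖ ^ 2
      ≤ (2 * L + 2 * (L * ρ) / ρ) * ((L * ρ) ^ 2 + 1) * (1 + ‖z‖ ^ 2) := by
    calc L * ‖V y + z‖ ^ 2 ≤ L * (2 * (L * ρ) ^ 2 + 2 * ‖z‖ ^ 2) := by gcongr
      _ ≤ 2 * L * (((L * ρ) ^ 2 + 1) * (1 + ‖z‖ ^ 2)) := by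
        have : 0 ≤ 2 * L * (1 + (L * ρ) ^ 2 * ‖z‖ ^ 2) := by positivity
        linarith
      _ ≤ (2 * L + 2 * (L * ρ) / ρ) * (((L * ρ) ^ 2 + 1) * (1 + ‖z‖ ^ 2)) := by
        have : 0 ≤ 2 * (L * ρ) / ρ := by positivity
        gcongr
        linarith
      _ = _ := by ring
  rw [e2, h1]
  have h7 := h.stable y' hy'
  have h8 := mul_le_mul_of_nonneg_left h6 hg
  have h9 : τ ^ 2 * ‖y - x‖ ^ 2 + inner ℝ (V y) z
      - (2 * L + 2 * (L * ρ) / ρ) * ((L * ρ) ^ 2 + 1) * g * (1 + ‖z‖ ^ 2)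
      ≤ ‖V y‖ ^ 2 + inner ℝ (V y) z + inner ℝ (V y' - V y) (V y + z) := by linarith
  have h10 := mul_le_mul_of_nonneg_left h9 hg
  linarith

lemma radius_le_of_lead_notMem (hg : 0 ≤ g) (hy : y ∈ Metric.ball x (ρ / 2))
    (hy' : y' ∉ Metric.ball x ρ) (hstep : y' = y - g • (V y + z)) : ρ / 2 ≤ g * ‖V y + z‖ := by
  rw [mem_ball_iff_norm] at hy hy'
  have : ‖y' - x‖ ≤ ‖y - x‖ + g * ‖V y + z‖ := by
    have e : y' - x = (y - x) - g • (V y + z) := by rw [hstep]; abel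
    rw [e]
    refine (norm_sub_le _ _).trans_eq ?_
    rw [norm_smul, Real.norm_of_nonneg hg]
  linarith

lemma half_mem (hρ : 0 < ρ) (hy : y ∈ Metric.ball x (ρ / 2)) : y ∈ Metric.ball x ρ :=
  Metric.ball_subset_ball (by linarith) hy

/-- When the leading state escapes, `g (L ρ + ‖z‖) ≥ ρ / 2`. Multiplying the first-order noise term
by `2 / ρ` times this quantity, which is at least `1`, makes it second order, so the error term
dominates it. Thus the lower bound of `inner_lead_ge`, without its growth term, can be integrated
over the escape event too. -/
lemma inner_noise_le (h : RegularOnBall V x L τ ρ) (hg : 0 ≤ g) (hy : y ∈ Metric.ball x (ρ / 2))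
    (hy' : y' ∉ Metric.ball x ρ) (hstep : y' = y - g • (V y + z)) :
    g * (inner ℝ (V y) z - (2 * L + 2 * (L * ρ) / ρ) * ((L * ρ) ^ 2 + 1) * g * (1 + ‖z‖ ^ 2))
      ≤ 0 := by
  have hρ := h.ρ_pos
  have hL := h.L_nonneg
  have hV := h.norm_le (half_mem hρ hy)
  have h1 := radius_le_of_lead_notMem hg hy hy' hstep
  have h2 : inner ℝ (V y) z ≤ (L * ρ) * ‖z‖ :=
    (real_inner_le_norm _ _).trans (mul_le_mul_of_nonneg_right hV (norm_nonneg _))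
  have h3 : ‖V y + z‖ ≤ L * ρ + ‖z‖ := (norm_add_le _ _).trans (by linarith)
  have h4 : 1 ≤ 2 / ρ * (g * (L * ρ + ‖z‖)) := by
    have : ρ / 2 ≤ g * (L * ρ + ‖z‖) := h1.trans (by gcongr)
    rw [div_mul_eq_mul_div, le_div_iff₀ hρ]
    linarith
  have hz := norm_nonneg z
  have hLρ : 0 ≤ L * ρ := by positivity
  have h5 : ‖z‖ * (L * ρ + ‖z‖) ≤ ((L * ρ) ^ 2 + 1) * (1 + ‖z‖ ^ 2) := by
    nlinarith [sq_nonneg (L * ρ - ‖z‖), sq_nonneg (L * ρ * ‖z‖)]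
  refine mul_nonpos_of_nonneg_of_nonpos hg ?_
  have h6 : inner ℝ (V y) z ≤ 2 * (L * ρ) / ρ * ((L * ρ) ^ 2 + 1) * g * (1 + ‖z‖ ^ 2) := by
    calc inner ℝ (V y) z ≤ (L * ρ) * ‖z‖ * 1 := by linarith
      _ ≤ (L * ρ) * ‖z‖ * (2 / ρ * (g * (L * ρ + ‖z‖))) := by gcongr
      _ = 2 * (L * ρ) / ρ * g * (‖z‖ * (L * ρ + ‖z‖)) := by ring
      _ ≤ 2 * (L * ρ) / ρ * g * (((L * ρ) ^ 2 + 1) * (1 + ‖z‖ ^ 2)) := by gcongr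
      _ = _ := by ring
  have h7 : 0 ≤ 2 * L * ((L * ρ) ^ 2 + 1) * g * (1 + ‖z‖ ^ 2) := by positivity
  linarith

/-- `V` need not be measurable far from `x`, so the integrals below use its truncation to the ball.
-/
lemma measurable_indicator (h : RegularOnBall V x L τ ρ) :
    Measurable ((Metric.ball x ρ).indicator V) := by
  classical
  have hc : ContinuousOn V (Metric.ball x ρ) := by
    refine (LipschitzOnWith.of_dist_le_mul (K := ⟨L, h.L_nonneg⟩) fun a ha b hb => ?_).continuousOn
    rw [dist_eq_norm, dist_eq_norm]
    exact h.lip a ha b hb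
  have := hc.measurable_piecewise (g := 0) continuousOn_const measurableSet_ball
  rwa [Set.piecewise_eq_indicator] at this

lemma norm_indicator_le (h : RegularOnBall V x L τ ρ) (y : EuclideanSpace ℝ (Fin d)) :
    ‖(Metric.ball x ρ).indicator V y‖ ≤ L * ρ := by
  by_cases hy : y ∈ Metric.ball x ρ
  · rw [Set.indicator_of_mem hy]; exact h.norm_le hy
  · rw [Set.indicator_of_notMem hy, norm_zero]; exact mul_nonneg h.L_nonneg h.ρ_pos.le

end RegularOnBall

lemma exists_regularOnBall {d : ℕ} {V : EuclideanSpace ℝ (Fin d) → EuclideanSpace ℝ (Fin d)}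
    {x : EuclideanSpace ℝ (Fin d)} (hx : V x = 0) {L : ℝ≥0} (hL : LipschitzNear L V x)
    (hmono : StableNear V x) (hJ : RegularJacobian V x) :
    ∃ τ > 0, ∃ ρ₀ > 0, ∀ ρ, 0 < ρ → ρ ≤ ρ₀ → RegularOnBall V x L τ ρ := by
  obtain ⟨s, hs, hLs⟩ := hL
  obtain ⟨hdiff, e, he⟩ := hJ
  have hanti := e.antilipschitz
  set K : ℝ≥0 := ‖(e.symm : EuclideanSpace ℝ (Fin d) →L[ℝ] EuclideanSpace ℝ (Fin d))‖₊
  have hfd := hdiff.hasFDerivAt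
  rw [hasFDerivAt_iff_isLittleO] at hfd
  -- The derivative expands by at least `1 / (K + 1) = 2 * c`; a linearization error of rate `c`
  -- leaves growth rate `c`.
  set c : ℝ := 1 / (2 * (K + 1))
  have hc : 0 < c := by positivity
  have hsmall := hfd.def hc
  have hgrow : ∀ᶠ y in 𝓝 x, c * ‖y - x‖ ≤ ‖V y‖ := by
    filter_upwards [hsmall] with y hy
    rw [hx, sub_zero] at hy
    have h1 : ‖y - x‖ ≤ K * ‖fderiv ℝ V x (y - x)‖ := by
      have := hanti.le_mul_dist (y - x) 0
      rw [dist_zero_right, map_zero, dist_zero_right] at this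
      rw [← he]
      exact this
    have h2 : ‖fderiv ℝ V x (y - x)‖ ≤ ‖V y‖ + ‖V y - fderiv ℝ V x (y - x)‖ := by
      have := norm_sub_le (V y) (V y - fderiv ℝ V x (y - x))
      rwa [sub_sub_cancel] at this
    have h3 : 2 * c * ‖y - x‖ ≤ ‖fderiv ℝ V x (y - x)‖ := by
      have : 2 * c = 1 / ((K : ℝ) + 1) := by simp only [c]; field_simp
      rw [this, div_mul_eq_mul_div, one_mul, div_le_iff₀ (by positivity)]
      linarith [norm_nonneg (fderiv ℝ V x (y - x))]
    linarith
  obtain ⟨ρ₀, hρ₀, hball⟩ := Metric.eventually_nhds_iff_ball.1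
    ((eventually_mem_set.2 hs).and (hmono.and hgrow))
  refine ⟨c, hc, ρ₀, hρ₀, fun ρ hρ hle => ?_⟩
  have hsub : ∀ y ∈ Metric.ball x ρ, y ∈ Metric.ball x ρ₀ :=
    fun y hy => Metric.ball_subset_ball hle hy
  refine ⟨L.2, hc.le, hρ, hx, fun y hy y' hy' => ?_, fun y hy => (hball y (hsub y hy)).2.1,
    fun y hy => (hball y (hsub y hy)).2.2⟩
  have := hLs.dist_le_mul y (hball y (hsub y hy)).1 y' (hball y' (hsub y' hy')).1
  rwa [dist_eq_norm, dist_eq_norm] at this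

/-! ### One-step estimates in expectation -/

section OneStep

variable {d : ℕ} {Ω : Type*} {m m' mΩ : MeasurableSpace Ω} {μ : Measure Ω} [IsProbabilityMeasure μ]
  {V : EuclideanSpace ℝ (Fin d) → EuclideanSpace ℝ (Fin d)}
  {x : EuclideanSpace ℝ (Fin d)} {r p σ κ ρ L τ g e : ℝ}
  {Y Y' Y₁ Z Z' : Ω → EuclideanSpace ℝ (Fin d)} {A : Set Ω}

/-- The noise `Z` averages to zero over `A`, not over the part of `A` where `Y'` stays in the ball.
The lower bound is therefore integrated over all of `A`, with the growth and inner-product terms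
switched off where `Y'` escapes. -/
lemma setIntegral_inner_lead_ge (hreg : RegularOnBall V x L τ ρ) (hρr : ρ ≤ r) (hp : 2 ≤ p)
    (hσ : 0 ≤ σ) (hκ : 0 ≤ κ) (hm : m ≤ mΩ)
    (hY : Measurable[m] Y) (hY' : Measurable Y') (hZ : Measurable Z)
    (hN : LocalNoise μ x r p σ κ m Y Z) (hg : 0 ≤ g)
    (hstep : ∀ ω, Y' ω = Y ω - g • (V (Y ω) + Z ω))
    (hA : MeasurableSet[m] A) (hAY : ∀ ω ∈ A, Y ω ∈ Metric.ball x (ρ / 2)) :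
    IntegrableOn (fun ω => inner ℝ ((Metric.ball x ρ).indicator V (Y' ω)) (Y ω - x))
      (A ∩ Y' ⁻¹' Metric.ball x ρ) μ ∧
    g * (τ ^ 2 * ∫ ω in A ∩ Y' ⁻¹' Metric.ball x ρ, ‖Y ω - x‖ ^ 2 ∂μ
      - (2 * L + 2 * (L * ρ) / ρ) * ((L * ρ) ^ 2 + 1) * g * (1 + (1 + (σ + κ * ρ) ^ p))
        * μ.real A)
      ≤ ∫ ω in A ∩ Y' ⁻¹' Metric.ball x ρ,
          inner ℝ ((Metric.ball x ρ).indicator V (Y' ω)) (Y ω - x) ∂μ := by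
  have hρ := hreg.ρ_pos
  have hL := hreg.L_nonneg
  have hAρ : ∀ ω ∈ A, Y ω ∈ Metric.ball x ρ := fun ω hω => RegularOnBall.half_mem hρ (hAY ω hω)
  have hAr : ∀ ω ∈ A, Y ω ∈ Metric.ball x r := fun ω hω => Metric.ball_subset_ball hρr (hAρ ω hω)
  have hYΩ : Measurable Y := hY.mono hm le_rfl
  have hBΩ : MeasurableSet (Y' ⁻¹' Metric.ball x ρ) := hY' measurableSet_ball
  have hAΩ : MeasurableSet A := hm _ hA
  have hVm := hreg.measurable_indicator
  set Vb := (Metric.ball x ρ).indicator V with hVb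
  set K := (2 * L + 2 * (L * ρ) / ρ) * ((L * ρ) ^ 2 + 1) with hK
  have hK0 : 0 ≤ K := by positivity
  have hVbmem : ∀ y ∈ Metric.ball x ρ, Vb y = V y := fun y hy => Set.indicator_of_mem hy _
  have hnorm : ∀ ω ∈ A, ‖Y ω - x‖ ≤ ρ := fun ω hω => (mem_ball_iff_norm.1 (hAρ ω hω)).le
  have hF : IntegrableOn (fun ω => inner ℝ (Vb (Y' ω)) (Y ω - x)) A μ := by
    refine Measure.integrableOn_of_bounded (M := (L * ρ) * ρ) (measure_ne_top _ _)
      ((hVm.comp hY').inner (hYΩ.sub_const x)).aestronglyMeasurable ?_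
    refine (ae_restrict_iff' hAΩ).2 (ae_of_all _ fun ω hω => ?_)
    exact (norm_inner_le_norm _ _).trans (mul_le_mul (hreg.norm_indicator_le _) (hnorm ω hω)
      (norm_nonneg _) (by positivity))
  have hD : IntegrableOn (fun ω => ‖Y ω - x‖ ^ 2) A μ := by
    refine Measure.integrableOn_of_bounded (M := ρ ^ 2) (measure_ne_top _ _)
      (((hYΩ.sub_const x).norm).pow_const 2).aestronglyMeasurable ?_
    refine (ae_restrict_iff' hAΩ).2 (ae_of_all _ fun ω hω => ?_)
    rw [Real.norm_of_nonneg (by positivity)]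
    exact pow_le_pow_left₀ (norm_nonneg _) (hnorm ω hω) 2
  obtain ⟨hI, hI0⟩ := hN.integrableOn_inner_and_setIntegral_eq_zero hm hZ hp hY hA hAr
    (w := fun ω => Vb (Y ω)) (hVm.comp hY) (C := L * ρ) (by positivity)
    (fun ω _ => hreg.norm_indicator_le _)
  have hZ2 := hN.integrableOn_sq hm hZ hp hA hAr
  have hZ2le := hN.setIntegral_sq_le hm hZ hp hσ hκ hρr hA hAρ
  have hone : IntegrableOn (fun _ : Ω => (1 : ℝ)) A μ := (integrable_const _).integrableOn
  refine ⟨hF.mono_set Set.inter_subset_left, ?_⟩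
  have hDB : IntegrableOn ((Y' ⁻¹' Metric.ball x ρ).indicator (fun ω => ‖Y ω - x‖ ^ 2)) A μ :=
    Integrable.indicator hD hBΩ
  have hFB : IntegrableOn ((Y' ⁻¹' Metric.ball x ρ).indicator
      (fun ω => inner ℝ (Vb (Y' ω)) (Y ω - x))) A μ := Integrable.indicator hF hBΩ
  have hlow : IntegrableOn (fun ω => g * (τ ^ 2 *
      (Y' ⁻¹' Metric.ball x ρ).indicator (fun ω => ‖Y ω - x‖ ^ 2) ω
      + inner ℝ (Vb (Y ω)) (Z ω) - K * g * (1 + ‖Z ω‖ ^ 2))) A μ :=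
    (((hDB.const_mul _).add hI).sub ((hone.add hZ2).const_mul _)).const_mul g
  -- On the escape part the right-hand side is zero, and the left-hand side is nonpositive by
  -- `inner_noise_le`.
  have hmono := setIntegral_mono_on hlow hFB hAΩ fun ω hω => by
    rw [hVbmem _ (hAρ ω hω)]
    by_cases hB : ω ∈ Y' ⁻¹' Metric.ball x ρ
    · rw [Set.indicator_of_mem hB, Set.indicator_of_mem hB, hVbmem _ hB]
      exact hreg.inner_lead_ge hg (hAρ ω hω) hB (hstep ω)
    · rw [Set.indicator_of_notMem hB, Set.indicator_of_notMem hB, mul_zero, zero_add]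
      exact hreg.inner_noise_le hg (hAY ω hω) hB (hstep ω)
  rw [setIntegral_indicator hBΩ, integral_const_mul, integral_sub, integral_add, hI0,
    integral_const_mul, integral_const_mul, integral_add hone hZ2, setIntegral_const,
    setIntegral_indicator hBΩ, smul_eq_mul, mul_one, add_zero] at hmono
  · refine le_trans (mul_le_mul_of_nonneg_left ?_ hg) hmono
    have := mul_le_mul_of_nonneg_left hZ2le (mul_nonneg hK0 hg)
    linarith
  · exact hDB.const_mul _
  · exact hI
  · exact (hDB.const_mul _).add hI
  · exact (hone.add hZ2).const_mul _

/-- Expand the square of the update. The domain belongs to the later history `m'`, so the cross term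
with `Z'` vanishes, and the term with `V (Y' ω)` yields the contraction. -/
lemma setIntegral_next_le (hreg : RegularOnBall V x L τ ρ) (hρr : ρ ≤ r) (hp : 2 ≤ p)
    (hσ : 0 ≤ σ) (hκ : 0 ≤ κ) (hmm' : m ≤ m') (hm' : m' ≤ mΩ)
    (hY : Measurable[m] Y) (hY' : Measurable[m'] Y') (hY₁ : Measurable Y₁)
    (hZ : Measurable Z) (hZ' : Measurable Z')
    (hN : LocalNoise μ x r p σ κ m Y Z) (hN' : LocalNoise μ x r p σ κ m' Y' Z')
    (hg : 0 ≤ g) (he : 0 ≤ e)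
    (hstep : ∀ ω, Y' ω = Y ω - g • (V (Y ω) + Z ω))
    (hstep' : ∀ ω, Y₁ ω = Y ω - e • (V (Y' ω) + Z' ω))
    (hA : MeasurableSet[m] A) (hAY : ∀ ω ∈ A, Y ω ∈ Metric.ball x (ρ / 2)) :
    IntegrableOn (fun ω => ‖Y₁ ω - x‖ ^ 2) (A ∩ Y' ⁻¹' Metric.ball x ρ) μ ∧
    ∫ ω in A ∩ Y' ⁻¹' Metric.ball x ρ, ‖Y₁ ω - x‖ ^ 2 ∂μ
      ≤ (1 - 2 * (e * g) * τ ^ 2) * ∫ ω in A ∩ Y' ⁻¹' Metric.ball x ρ, ‖Y ω - x‖ ^ 2 ∂μ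
        + stepConst L ρ (1 + (σ + κ * ρ) ^ p) * (e * g ^ 2 + e ^ 2) * μ.real A := by
  have hρ := hreg.ρ_pos
  have hL := hreg.L_nonneg
  obtain ⟨hF, hFle⟩ := setIntegral_inner_lead_ge hreg hρr hp hσ hκ (hmm'.trans hm') hY
    (hY'.mono hm' le_rfl) hZ hN hg hstep hA hAY
  set B := A ∩ Y' ⁻¹' Metric.ball x ρ with hBdef
  have hB : MeasurableSet[m'] B := (hmm' _ hA).inter (hY' measurableSet_ball)
  have hBΩ : MeasurableSet B := hm' _ hB
  have hBρ : ∀ ω ∈ B, Y' ω ∈ Metric.ball x ρ := fun ω hω => hω.2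
  have hBr : ∀ ω ∈ B, Y' ω ∈ Metric.ball x r := fun ω hω => Metric.ball_subset_ball hρr hω.2
  have hnorm : ∀ ω ∈ B, ‖Y ω - x‖ ≤ ρ := fun ω hω =>
    (mem_ball_iff_norm.1 (RegularOnBall.half_mem hρ (hAY ω hω.1))).le
  have hY'' : Measurable[m'] Y := hY.mono hmm' le_rfl
  have hYΩ : Measurable Y := hY''.mono hm' le_rfl
  have hD : IntegrableOn (fun ω => ‖Y ω - x‖ ^ 2) B μ := by
    refine Measure.integrableOn_of_bounded (M := ρ ^ 2) (measure_ne_top _ _)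
      (((hYΩ.sub_const x).norm).pow_const 2).aestronglyMeasurable ?_
    refine (ae_restrict_iff' hBΩ).2 (ae_of_all _ fun ω hω => ?_)
    rw [Real.norm_of_nonneg (by positivity)]
    exact pow_le_pow_left₀ (norm_nonneg _) (hnorm ω hω) 2
  obtain ⟨hI, hI0⟩ := hN'.integrableOn_inner_and_setIntegral_eq_zero hm' hZ' hp hY' hB hBr
    (w := fun ω => Y ω - x) (hY''.sub_const x) (C := ρ) hρ.le hnorm
  have hZ2 := hN'.integrableOn_sq hm' hZ' hp hB hBr
  have hZ2le := hN'.setIntegral_sq_le hm' hZ' hp hσ hκ hρr hB hBρ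
  have hcst : ∀ c : ℝ, IntegrableOn (fun _ : Ω => c) B μ :=
    fun c => (integrable_const _).integrableOn
  set S := 1 + (σ + κ * ρ) ^ p with hS
  have hS0 : 0 ≤ S := by positivity
  set Vb := (Metric.ball x ρ).indicator V with hVb
  have hup : IntegrableOn (fun ω => ‖Y ω - x‖ ^ 2 - 2 * e * inner ℝ (Vb (Y' ω)) (Y ω - x)
      - 2 * e * inner ℝ (Y ω - x) (Z' ω)
      + (2 * (L * ρ) ^ 2 * e ^ 2 + 2 * e ^ 2 * ‖Z' ω‖ ^ 2)) B μ :=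
    ((hD.sub (hF.const_mul _)).sub (hI.const_mul _)).add ((hcst _).add (hZ2.const_mul _))
  have hpt : ∀ ω ∈ B, ‖Y₁ ω - x‖ ^ 2 ≤ ‖Y ω - x‖ ^ 2 - 2 * e * inner ℝ (Vb (Y' ω)) (Y ω - x)
      - 2 * e * inner ℝ (Y ω - x) (Z' ω)
      + (2 * (L * ρ) ^ 2 * e ^ 2 + 2 * e ^ 2 * ‖Z' ω‖ ^ 2) := fun ω hω => by
    have e1 : Y₁ ω - x = (Y ω - x) - e • (V (Y' ω) + Z' ω) := by rw [hstep']; abel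
    have e2 : Vb (Y' ω) = V (Y' ω) := Set.indicator_of_mem (hBρ ω hω) _
    rw [e1, norm_sub_sq_real, real_inner_smul_right, inner_add_right, norm_smul, mul_pow,
      Real.norm_of_nonneg he, e2, real_inner_comm (Y ω - x) (V (Y' ω))]
    have := mul_le_mul_of_nonneg_left (hreg.norm_add_sq_le hω.2 (Z' ω)) (sq_nonneg e)
    linarith
  have hY₁int : IntegrableOn (fun ω => ‖Y₁ ω - x‖ ^ 2) B μ := by
    refine Integrable.mono' hup ((hY₁.sub_const x).norm.pow_const 2).aestronglyMeasurable ?_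
    refine (ae_restrict_iff' hBΩ).2 (ae_of_all _ fun ω hω => ?_)
    rw [Real.norm_of_nonneg (by positivity)]
    exact hpt ω hω
  refine ⟨hY₁int, ?_⟩
  have hmono := setIntegral_mono_on hY₁int hup hBΩ hpt
  rw [integral_add, integral_sub, integral_sub, integral_const_mul, integral_const_mul, hI0,
    integral_add (hcst _) (hZ2.const_mul _), setIntegral_const, integral_const_mul,
    smul_eq_mul] at hmono
  · refine hmono.trans ?_
    have hμ : μ.real B ≤ μ.real A := measureReal_mono Set.inter_subset_left
    have hμ0 : 0 ≤ μ.real A := measureReal_nonneg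
    have i1 := mul_le_mul_of_nonneg_left hFle (mul_nonneg zero_le_two he)
    have i2 := mul_le_mul_of_nonneg_left (hZ2le.trans (mul_le_mul_of_nonneg_left hμ hS0))
      (mul_nonneg zero_le_two (sq_nonneg e))
    have i3 := mul_le_mul_of_nonneg_right hμ (show 0 ≤ 2 * (L * ρ) ^ 2 * e ^ 2 by positivity)
    -- The errors in `e * g ^ 2` and in `e ^ 2` carry different constants; `i4` and `i5` pad both up
    -- to `stepConst`.
    have i4 : 0 ≤ (4 * L + 4 * (L * ρ) / ρ) * ((L * ρ) ^ 2 + 1) * (1 + S) * e ^ 2 * μ.real A := by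
      positivity
    have i5 : 0 ≤ (2 * (L * ρ) ^ 2 + 2 * S) * (e * g ^ 2) * μ.real A := by positivity
    unfold stepConst
    have e4 : 4 * (L * ρ) / ρ = 2 * (2 * (L * ρ) / ρ) := by ring
    rw [e4] at i4 ⊢
    set q := 2 * (L * ρ) / ρ
    linarith
  · exact hD
  · exact hF.const_mul _
  · exact hD.sub (hF.const_mul _)
  · exact hI.const_mul _
  · exact (hD.sub (hF.const_mul _)).sub (hI.const_mul _)
  · exact (hcst _).add (hZ2.const_mul _)

/-- Markov's inequality for the `p`-th moment. An escape needs a displacement of at least `ρ / 2`,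
of which the field supplies at most `ρ / 4`, so `g ‖Z‖ ≥ ρ / 4`. -/
lemma measureReal_lead_exit_le (hreg : RegularOnBall V x L τ ρ) (hρr : ρ ≤ r) (hp : 0 < p)
    (hσ : 0 ≤ σ) (hκ : 0 ≤ κ) (hm : m ≤ mΩ) (hY' : Measurable Y')
    (hN : LocalNoise μ x r p σ κ m Y Z) (hg : 0 ≤ g) (hgL : g * (L * ρ) ≤ ρ / 4)
    (hstep : ∀ ω, Y' ω = Y ω - g • (V (Y ω) + Z ω))
    (hA : MeasurableSet[m] A) (hAY : ∀ ω ∈ A, Y ω ∈ Metric.ball x (ρ / 2)) :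
    μ.real (A \ Y' ⁻¹' Metric.ball x ρ)
      ≤ (4 / ρ * (σ + κ * ρ)) ^ p * g ^ p * μ.real A := by
  have hρ := hreg.ρ_pos
  have hAρ : ∀ ω ∈ A, Y ω ∈ Metric.ball x ρ := fun ω hω => RegularOnBall.half_mem hρ (hAY ω hω)
  have hAr : ∀ ω ∈ A, Y ω ∈ Metric.ball x r := fun ω hω => Metric.ball_subset_ball hρr (hAρ ω hω)
  have hAΩ : MeasurableSet A := hm _ hA
  have hBΩ : MeasurableSet (Y' ⁻¹' Metric.ball x ρ) := hY' measurableSet_ball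
  have hi := (hN.integrableOn_rpow hm hA hAr).const_mul ((4 / ρ * g) ^ p)
  have hle := hN.setIntegral_rpow_le hm hp.le hσ hκ hρr hA hAρ
  calc μ.real (A \ Y' ⁻¹' Metric.ball x ρ)
      = ∫ ω in A, (Y' ⁻¹' Metric.ball x ρ)ᶜ.indicator (fun _ => (1 : ℝ)) ω ∂μ := by
        rw [setIntegral_indicator hBΩ.compl, setIntegral_const, smul_eq_mul, mul_one,
          Set.sdiff_eq]
    _ ≤ ∫ ω in A, (4 / ρ * g) ^ p * ‖Z ω‖ ^ p ∂μ := by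
        refine setIntegral_mono_on (Integrable.indicator (integrable_const _) hBΩ.compl) hi hAΩ
          fun ω hω => ?_
        by_cases hB : ω ∈ Y' ⁻¹' Metric.ball x ρ
        · rw [Set.indicator_of_notMem (by simpa using hB)]
          positivity
        · rw [Set.indicator_of_mem (by simpa using hB),
            ← Real.mul_rpow (by positivity) (norm_nonneg _)]
          refine Real.one_le_rpow ?_ hp.le
          have h1 := RegularOnBall.radius_le_of_lead_notMem hg (hAY ω hω) hB (hstep ω)
          have h2 : g * ‖V (Y ω) + Z ω‖ ≤ g * (L * ρ) + g * ‖Z ω‖ := by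
            rw [← mul_add]
            exact mul_le_mul_of_nonneg_left
              ((norm_add_le _ _).trans (by linarith [hreg.norm_le (hAρ ω hω)])) hg
          have h3 : ρ / 4 ≤ g * ‖Z ω‖ := by linarith
          rw [mul_assoc, div_mul_eq_mul_div, le_div_iff₀ hρ]
          linarith
    _ = (4 / ρ * g) ^ p * ∫ ω in A, ‖Z ω‖ ^ p ∂μ := integral_const_mul _ _
    _ ≤ (4 / ρ * g) ^ p * ((σ + κ * ρ) ^ p * μ.real A) := by gcongr
    _ = _ := by
        rw [Real.mul_rpow (by positivity) hg, Real.mul_rpow (by positivity) (by positivity)]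
        ring

end OneStep

/-! ### Shifted power sums and the rate recursion -/

lemma exists_forall_sum_shift_rpow_le {α ε : ℝ} (hα : 1 < α) (hε : 0 < ε) :
    ∃ b₀ : ℝ, 0 < b₀ ∧ ∀ b, b₀ ≤ b → ∀ T : ℕ,
      ∑ t ∈ Finset.range T, (((t + 1 : ℕ) : ℝ) + b) ^ (-α) ≤ ε := by
  -- Half of the excess `α - 1` keeps the series convergent; the other half becomes the factor `b ^
  -- (-β)`, uniform in `T`.
  set β := (α - 1) / 2 with hβ
  have hβ0 : 0 < β := by linarith
  have hsum : Summable fun t : ℕ => ((t + 1 : ℕ) : ℝ) ^ (-(1 + β)) :=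
    (summable_nat_add_iff 1).2 (Real.summable_nat_rpow.2 (by linarith))
  set S := ∑' t : ℕ, ((t + 1 : ℕ) : ℝ) ^ (-(1 + β)) with hS
  have hS0 : 0 ≤ S := tsum_nonneg fun t => by positivity
  have hlim : Tendsto (fun b : ℝ => b ^ (-β) * S) atTop (𝓝 0) := by
    simpa using (tendsto_rpow_neg_atTop hβ0).mul_const S
  obtain ⟨b₁, hb₁⟩ := eventually_atTop.1 (hlim.eventually (eventually_le_nhds hε))
  refine ⟨max b₁ 1, by positivity, fun b hb T => ?_⟩
  have hb0 : 0 < b := lt_of_lt_of_le one_pos ((le_max_right _ _).trans hb)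
  calc ∑ t ∈ Finset.range T, (((t + 1 : ℕ) : ℝ) + b) ^ (-α)
      ≤ ∑ t ∈ Finset.range T, b ^ (-β) * ((t + 1 : ℕ) : ℝ) ^ (-(1 + β)) := by
        refine Finset.sum_le_sum fun t _ => ?_
        have ht : (0 : ℝ) < ((t + 1 : ℕ) : ℝ) := by positivity
        have e : -α = -β + -(1 + β) := by rw [hβ]; ring
        rw [e, Real.rpow_add (by positivity)]
        refine mul_le_mul ?_ ?_ (by positivity) (by positivity)
        · exact Real.rpow_le_rpow_of_nonpos hb0 (by linarith) (by linarith)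
        · exact Real.rpow_le_rpow_of_nonpos ht (by linarith) (by linarith)
    _ = b ^ (-β) * ∑ t ∈ Finset.range T, ((t + 1 : ℕ) : ℝ) ^ (-(1 + β)) := by
        rw [Finset.mul_sum]
    _ ≤ b ^ (-β) * S := by
        gcongr
        exact hsum.sum_le_tsum _ fun t _ => by positivity
    _ ≤ ε := hb₁ b ((le_max_left _ _).trans hb)

lemma one_sub_inv_mul_rpow_le {s : ℝ} (hs : 1 ≤ s) :
    (1 - 1 / s) * s ^ (-(1 / 3) : ℝ) ≤ (s + 1) ^ (-(1 / 3) : ℝ) := by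
  have hs0 : 0 < s := by linarith
  have h1 : 1 - 1 / s ≤ s / (s + 1) := by
    rw [le_div_iff₀ (by linarith), sub_mul, one_div_mul_eq_div, sub_le_iff_le_add, one_mul,
      ← sub_le_iff_le_add', le_div_iff₀ hs0]
    linarith
  have h2 : s / (s + 1) ≤ (s / (s + 1)) ^ (1 / 3 : ℝ) :=
    Real.self_le_rpow_of_le_one (by positivity) ((div_le_one (by linarith)).2 (by linarith))
      (by norm_num)
  calc (1 - 1 / s) * s ^ (-(1 / 3) : ℝ)
      ≤ (s / (s + 1)) ^ (1 / 3 : ℝ) * s ^ (-(1 / 3) : ℝ) := by gcongr; exact h1.trans h2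
    _ = (s + 1) ^ (-(1 / 3) : ℝ) := by
        rw [Real.div_rpow hs0.le (by linarith), Real.rpow_neg hs0.le, Real.rpow_neg (by linarith)]
        field_simp

/-- Of the contraction `2 / s`, one `1 / s` absorbs the forcing term and the other pays for passing
from `s ^ (-1/3)` to `(s + 1) ^ (-1/3)`. -/
lemma le_mul_rpow_of_recursion {a : ℕ → ℝ} {b K : ℝ} (hb : 1 ≤ b) (hK : 0 ≤ K)
    (hrec : ∀ t : ℕ, 1 ≤ t →
      a (t + 1) ≤ (1 - 2 / (t + b)) * a t + K * ((t : ℝ) + b) ^ (-(4 / 3) : ℝ)) :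
    ∃ M : ℝ, 0 ≤ M ∧ ∀ t : ℕ, 1 ≤ t → a t ≤ M * ((t : ℝ) + b) ^ (-(1 / 3) : ℝ) := by
  -- The first entry absorbs the forcing term in the induction step, the second is what `t = 1`
  -- needs.
  refine ⟨max K (a 1 * (1 + b) ^ (1 / 3 : ℝ)), hK.trans (le_max_left _ _), fun t ht => ?_⟩
  set M := max K (a 1 * (1 + b) ^ (1 / 3 : ℝ))
  have hM : K ≤ M := le_max_left _ _
  induction t, ht using Nat.le_induction with
  | base =>
    have h1 : a 1 * (1 + b) ^ (1 / 3 : ℝ) ≤ M := le_max_right _ _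
    rw [Real.rpow_neg (by positivity), ← div_eq_mul_inv, le_div_iff₀ (by positivity)]
    simpa using h1
  | succ t ht ih =>
    have ht' : (1 : ℝ) ≤ t := by exact_mod_cast ht
    set s : ℝ := t + b with hs
    have hs2 : 2 ≤ s := by linarith
    have hs0 : 0 < s := by linarith
    have h2s : 0 ≤ 1 - 2 / s := by rw [sub_nonneg, div_le_one hs0]; exact hs2
    have e : s ^ (-(4 / 3) : ℝ) = 1 / s * s ^ (-(1 / 3) : ℝ) := by
      rw [show (-(4 / 3) : ℝ) = -1 + -(1 / 3) by norm_num, Real.rpow_add hs0, Real.rpow_neg_one,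
        one_div s]
    have hcast : ((t + 1 : ℕ) : ℝ) + b = s + 1 := by push_cast; rw [hs]; ring
    rw [hcast]
    have hpos : 0 ≤ 1 / s * s ^ (-(1 / 3) : ℝ) := by positivity
    calc a (t + 1) ≤ (1 - 2 / s) * a t + K * s ^ (-(4 / 3) : ℝ) := hrec t ht
      _ ≤ (1 - 2 / s) * (M * s ^ (-(1 / 3) : ℝ)) + M * (1 / s * s ^ (-(1 / 3) : ℝ)) := by
        rw [e]; gcongr
      _ = M * ((1 - 1 / s) * s ^ (-(1 / 3) : ℝ)) := by ring
      _ ≤ M * (s + 1) ^ (-(1 / 3) : ℝ) :=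
        mul_le_mul_of_nonneg_left (one_sub_inv_mul_rpow_le (by linarith)) (hK.trans hM)

/-! ### Products and powers of the stepsizes -/

section StepSizes

variable {γ η b : ℝ} {t : ℕ}

lemma updateStep_mul_explorationStep (h : 0 < (t : ℝ) + b) :
    updateStep η b t * explorationStep γ b t = η * γ / (t + b) := by
  unfold updateStep explorationStep
  rw [div_mul_div_comm, ← Real.rpow_add h]
  norm_num

lemma updateStep_mul_explorationStep_sq_add (h : 0 < (t : ℝ) + b) :
    updateStep η b t * explorationStep γ b t ^ 2 + updateStep η b t ^ 2
      = (η * γ ^ 2 + η ^ 2) * ((t : ℝ) + b) ^ (-(4 / 3) : ℝ) := by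
  unfold updateStep explorationStep
  have e1 : (((t : ℝ) + b) ^ (1 / 3 : ℝ)) ^ 2 = ((t : ℝ) + b) ^ (2 / 3 : ℝ) := by
    rw [← Real.rpow_mul_natCast h.le]; norm_num
  have e2 : (((t : ℝ) + b) ^ (2 / 3 : ℝ)) ^ 2 = ((t : ℝ) + b) ^ (4 / 3 : ℝ) := by
    rw [← Real.rpow_mul_natCast h.le]; norm_num
  rw [div_pow, div_pow, e1, div_mul_div_comm, ← sq, e2, ← add_div, Real.rpow_neg h.le,
    div_eq_mul_inv]

lemma explorationStep_rpow (hγ : 0 ≤ γ) (h : 0 < (t : ℝ) + b) (p : ℝ) :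
    explorationStep γ b t ^ p = γ ^ p * ((t : ℝ) + b) ^ (-(p / 3)) := by
  unfold explorationStep
  rw [Real.div_rpow hγ (by positivity), ← Real.rpow_mul h.le, Real.rpow_neg h.le, div_eq_mul_inv]
  congr 3
  ring

end StepSizes

/-! ### Survival events and their measurability -/

/-- The event that the run starts in `U`, that the base states up to time `t` stay within `ρ / 2`
of `x`, and that the leading states before time `t` stay within `ρ`. -/
def stayEvent {d : ℕ} {Ω : Type*} (X Xh : ℕ → Ω → EuclideanSpace ℝ (Fin d))
    (x : EuclideanSpace ℝ (Fin d)) (ρ : ℝ) (U : Set (EuclideanSpace ℝ (Fin d))) (t : ℕ) : Set Ω :=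
  X 1 ⁻¹' U ∩ ((⋂ s ∈ Set.Icc 1 t, X s ⁻¹' Metric.ball x (ρ / 2)) ∩
    ⋂ s ∈ Set.Ico 1 t, Xh s ⁻¹' Metric.ball x ρ)

section Histories

variable {d : ℕ} {Ω : Type*} {X Xh : ℕ → Ω → EuclideanSpace ℝ (Fin d)} {s t : ℕ}

lemma measurable_base_baseHistory (hs : 1 ≤ s) (hst : s ≤ t) :
    Measurable[baseHistory X Xh t] (X s) :=
  Measurable.of_comap_le (le_sup_of_le_left (le_iSup₂_of_le s ⟨hs, hst⟩ le_rfl))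

lemma measurable_lead_baseHistory (hs : 1 ≤ s) (hst : s < t) :
    Measurable[baseHistory X Xh t] (Xh s) :=
  Measurable.of_comap_le (le_sup_of_le_right (le_iSup₂_of_le s ⟨hs, hst⟩ le_rfl))

lemma measurable_lead_leadHistory (ht : 1 ≤ t) : Measurable[leadHistory X Xh t] (Xh t) :=
  Measurable.of_comap_le (le_sup_of_le_right (le_iSup₂_of_le t ⟨ht, le_rfl⟩ le_rfl))

lemma baseHistory_le_leadHistory : baseHistory X Xh t ≤ leadHistory X Xh t :=
  sup_le_sup_left (biSup_mono fun _ h => ⟨h.1, h.2.le⟩) _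

lemma leadHistory_le {mΩ : MeasurableSpace Ω} (hX : ∀ t, 1 ≤ t → Measurable (X t))
    (hXh : ∀ t, 1 ≤ t → Measurable (Xh t)) : leadHistory X Xh t ≤ mΩ :=
  sup_le (iSup₂_le fun s hs => (hX s hs.1).comap_le) (iSup₂_le fun s hs => (hXh s hs.1).comap_le)

variable {x : EuclideanSpace ℝ (Fin d)} {ρ : ℝ} {U : Set (EuclideanSpace ℝ (Fin d))}

/-- Leaving out the leading state of time `t` itself is what makes the event known before the oracle
call at `X t`. -/
lemma measurableSet_stayEvent (hU : MeasurableSet U) (ht : 1 ≤ t) :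
    MeasurableSet[baseHistory X Xh t] (stayEvent X Xh x ρ U t) := by
  refine MeasurableSet.inter (measurable_base_baseHistory le_rfl ht hU) (MeasurableSet.inter ?_ ?_)
  · exact MeasurableSet.biInter (Set.to_countable _) fun s hs =>
      measurable_base_baseHistory hs.1 hs.2 measurableSet_ball
  · exact MeasurableSet.biInter (Set.to_countable _) fun s hs =>
      measurable_lead_baseHistory hs.1 hs.2 measurableSet_ball

lemma mem_stayEvent {ω : Ω} : ω ∈ stayEvent X Xh x ρ U t ↔ X 1 ω ∈ U ∧
    (∀ s, 1 ≤ s → s ≤ t → X s ω ∈ Metric.ball x (ρ / 2)) ∧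
    ∀ s, 1 ≤ s → s < t → Xh s ω ∈ Metric.ball x ρ := by
  simp only [stayEvent, Set.mem_inter_iff, Set.mem_preimage, Set.mem_iInter, Set.mem_Icc,
    Set.mem_Ico, and_imp]

lemma stayEvent_one (hU : U ⊆ Metric.ball x (ρ / 2)) : stayEvent X Xh x ρ U 1 = X 1 ⁻¹' U := by
  ext ω
  rw [mem_stayEvent]
  refine ⟨fun h => h.1, fun h => ⟨h, fun s hs hs' => ?_, fun s hs hs' => by omega⟩⟩
  obtain rfl : s = 1 := by omega
  exact hU h

lemma stayEvent_succ (ht : 1 ≤ t) : stayEvent X Xh x ρ U (t + 1)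
    = (stayEvent X Xh x ρ U t ∩ Xh t ⁻¹' Metric.ball x ρ) ∩
      X (t + 1) ⁻¹' Metric.ball x (ρ / 2) := by
  ext ω
  simp only [Set.mem_inter_iff, mem_stayEvent, Set.mem_preimage]
  constructor
  · rintro ⟨h0, h1, h2⟩
    exact ⟨⟨⟨h0, fun s hs hs' => h1 s hs (by omega), fun s hs hs' => h2 s hs (by omega)⟩,
      h2 t ht (by omega)⟩, h1 (t + 1) (by omega) le_rfl⟩
  · rintro ⟨⟨⟨h0, h1, h2⟩, h3⟩, h4⟩
    refine ⟨h0, fun s hs hs' => ?_, fun s hs hs' => ?_⟩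
    · rcases Nat.lt_or_ge t s with h | h
      · obtain rfl : s = t + 1 := by omega
        exact h4
      · exact h1 s hs h
    · rcases Nat.lt_or_ge s t with h | h
      · exact h2 s hs h
      · obtain rfl : s = t := by omega
        exact h3

lemma antitone_stayEvent : Antitone (stayEvent X Xh x ρ U) := fun s t hst ω hω => by
  rw [mem_stayEvent] at hω ⊢
  exact ⟨hω.1, fun u hu hu' => hω.2.1 u hu (hu'.trans hst),
    fun u hu hu' => hω.2.2 u hu (hu'.trans_le hst)⟩

end Histories

/-! ### Moment recursion and loss of survival probability -/

section Run

variable {d : ℕ} {Ω : Type*} [MeasurableSpace Ω] {μ : Measure Ω} [IsProbabilityMeasure μ]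
  {V : EuclideanSpace ℝ (Fin d) → EuclideanSpace ℝ (Fin d)}
  {x : EuclideanSpace ℝ (Fin d)} {r p σ κ ρ L τ γ η b : ℝ}
  {X Xh Z Zh : ℕ → Ω → EuclideanSpace ℝ (Fin d)} {U : Set (EuclideanSpace ℝ (Fin d))} {t : ℕ}

/-- The second inequality makes `P(E_t) - a_t / (ρ/2)²` almost nondecreasing: a base state that
escapes takes with it at least `(ρ/2)²` times its probability of second moment, so this loss
cancels; only leading escapes and the additive step error remain. -/
lemma stayEvent_step (hreg : RegularOnBall V x L τ ρ) (hρr : ρ ≤ r) (hp : 2 ≤ p)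
    (hσ : 0 ≤ σ) (hκ : 0 ≤ κ) (hγ : 0 ≤ γ) (hη : 0 ≤ η) (hb : 1 ≤ b)
    (hbγ : explorationStep γ b t * (L * ρ) ≤ ρ / 4)
    (hrate : 2 ≤ 2 * (η * γ) * τ ^ 2) (hbrate : 2 * (η * γ) * τ ^ 2 ≤ b)
    (hU : MeasurableSet U)
    (hrun : IsDSEG V (explorationStep γ b) (updateStep η b) X Xh Z Zh)
    (hN : ∀ t, 1 ≤ t → LocalNoise μ x r p σ κ (baseHistory X Xh t) (X t) (Z t))
    (hN' : ∀ t, 1 ≤ t → LocalNoise μ x r p σ κ (leadHistory X Xh t) (Xh t) (Zh t))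
    (ht : 1 ≤ t) :
    (∫ ω in stayEvent X Xh x ρ U (t + 1), ‖X (t + 1) ω - x‖ ^ 2 ∂μ
      ≤ (1 - 2 / (t + b)) * ∫ ω in stayEvent X Xh x ρ U t, ‖X t ω - x‖ ^ 2 ∂μ
        + stepConst L ρ (1 + (σ + κ * ρ) ^ p) * (η * γ ^ 2 + η ^ 2)
          * ((t : ℝ) + b) ^ (-(4 / 3) : ℝ) * μ.real (stayEvent X Xh x ρ U t)) ∧
    μ.real (stayEvent X Xh x ρ U t)
        - (∫ ω in stayEvent X Xh x ρ U t, ‖X t ω - x‖ ^ 2 ∂μ) / (ρ / 2) ^ 2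
        - ((4 / ρ * (σ + κ * ρ)) ^ p * γ ^ p * ((t : ℝ) + b) ^ (-(p / 3))
          + stepConst L ρ (1 + (σ + κ * ρ) ^ p) * (η * γ ^ 2 + η ^ 2) / (ρ / 2) ^ 2
            * ((t : ℝ) + b) ^ (-(4 / 3) : ℝ)) * μ.real (stayEvent X Xh x ρ U t)
      ≤ μ.real (stayEvent X Xh x ρ U (t + 1))
        - (∫ ω in stayEvent X Xh x ρ U (t + 1), ‖X (t + 1) ω - x‖ ^ 2 ∂μ) / (ρ / 2) ^ 2 := by
  have hρ := hreg.ρ_pos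
  have ht' : (1 : ℝ) ≤ t := by exact_mod_cast ht
  have hs0 : 0 < (t : ℝ) + b := by linarith
  have hhist := leadHistory_le (t := t) hrun.measurable_X hrun.measurable_Xh
  have hbase := (baseHistory_le_leadHistory (X := X) (Xh := Xh) (t := t)).trans hhist
  have hA : MeasurableSet[baseHistory X Xh t] (stayEvent X Xh x ρ U t) :=
    measurableSet_stayEvent hU ht
  have hAY : ∀ ω ∈ stayEvent X Xh x ρ U t, X t ω ∈ Metric.ball x (ρ / 2) :=
    fun ω hω => (mem_stayEvent.1 hω).2.1 t ht le_rfl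
  have hg : 0 ≤ explorationStep γ b t := div_nonneg hγ (by positivity)
  have he : 0 ≤ updateStep η b t := div_nonneg hη (by positivity)
  have hXt := hrun.measurable_X t ht
  have hXt1 := hrun.measurable_X (t + 1) (by omega)
  obtain ⟨hint, hnext⟩ := setIntegral_next_le hreg hρr hp hσ hκ baseHistory_le_leadHistory hhist
    (measurable_base_baseHistory ht le_rfl) (measurable_lead_leadHistory ht)
    hXt1 (hrun.measurable_Z t ht) (hrun.measurable_Zh t ht)
    (hN t ht) (hN' t ht) hg he (hrun.explore t ht) (hrun.update t ht) hA hAY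
  have hexit := measureReal_lead_exit_le hreg hρr (by linarith) hσ hκ hbase
    (hrun.measurable_Xh t ht) (hN t ht) hg hbγ (hrun.explore t ht) hA hAY
  rw [mul_assoc (stepConst _ _ _), updateStep_mul_explorationStep_sq_add hs0,
    updateStep_mul_explorationStep hs0] at hnext
  rw [explorationStep_rpow hγ hs0] at hexit
  rw [stayEvent_succ ht]
  set A := stayEvent X Xh x ρ U t
  set K := stepConst L ρ (1 + (σ + κ * ρ) ^ p)
  set B := A ∩ Xh t ⁻¹' Metric.ball x ρ
  set G := X (t + 1) ⁻¹' Metric.ball x (ρ / 2)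
  set s : ℝ := (t : ℝ) + b
  have hBΩ : MeasurableSet B := (hbase _ hA).inter (hrun.measurable_Xh t ht measurableSet_ball)
  have hG : MeasurableSet G := hXt1 measurableSet_ball
  have hD : IntegrableOn (fun ω => ‖X t ω - x‖ ^ 2) A μ := by
    refine Measure.integrableOn_of_bounded (M := (ρ / 2) ^ 2) (measure_ne_top _ _)
      (((hXt.sub_const x).norm).pow_const 2).aestronglyMeasurable ?_
    refine (ae_restrict_iff' (hbase _ hA)).2 (ae_of_all _ fun ω hω => ?_)
    rw [Real.norm_of_nonneg (by positivity)]
    exact pow_le_pow_left₀ (norm_nonneg _) (mem_ball_iff_norm.1 (hAY ω hω)).le 2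
  have hDB : ∫ ω in B, ‖X t ω - x‖ ^ 2 ∂μ ≤ ∫ ω in A, ‖X t ω - x‖ ^ 2 ∂μ :=
    setIntegral_mono_set hD (ae_of_all _ fun ω => by positivity)
      (Set.inter_subset_left (s := A) (t := Xh t ⁻¹' Metric.ball x ρ)).eventuallyLE
  have hDB0 : 0 ≤ ∫ ω in B, ‖X t ω - x‖ ^ 2 ∂μ := integral_nonneg fun ω => by positivity
  have hDA0 : 0 ≤ ∫ ω in A, ‖X t ω - x‖ ^ 2 ∂μ := integral_nonneg fun ω => by positivity
  have hc1 : 2 / s ≤ 2 * (η * γ / s) * τ ^ 2 := by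
    rw [mul_div_assoc', div_mul_eq_mul_div]
    gcongr
  have hc2 : 2 * (η * γ / s) * τ ^ 2 ≤ 1 := by
    rw [mul_div_assoc', div_mul_eq_mul_div, div_le_one hs0]
    linarith
  -- Enlarging the integral from `B` to `A` needs a nonnegative contraction factor, which is what `2
  -- * (η * γ) * τ ^ 2 ≤ b` provides through `hc2`.
  have hB : ∫ ω in B, ‖X (t + 1) ω - x‖ ^ 2 ∂μ
      ≤ (1 - 2 / s) * (∫ ω in A, ‖X t ω - x‖ ^ 2 ∂μ)
        + K * (η * γ ^ 2 + η ^ 2) * s ^ (-(4 / 3) : ℝ) * μ.real A := by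
    have h1 := mul_le_mul_of_nonneg_left hDB (sub_nonneg.2 hc2)
    have h2 := mul_le_mul_of_nonneg_right hc1 hDA0
    linarith
  -- The removed part of the second moment is kept, since it pays for the probability of `B \ G`.
  have hsplit : ∫ ω in B ∩ G, ‖X (t + 1) ω - x‖ ^ 2 ∂μ
      + ∫ ω in B \ G, ‖X (t + 1) ω - x‖ ^ 2 ∂μ = ∫ ω in B, ‖X (t + 1) ω - x‖ ^ 2 ∂μ :=
    integral_inter_add_sdiff hG hint
  have hout : (ρ / 2) ^ 2 * μ.real (B \ G) ≤ ∫ ω in B \ G, ‖X (t + 1) ω - x‖ ^ 2 ∂μ := by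
    calc (ρ / 2) ^ 2 * μ.real (B \ G) = ∫ _ in B \ G, (ρ / 2) ^ 2 ∂μ := by
          rw [setIntegral_const, smul_eq_mul, mul_comm]
      _ ≤ _ := by
        refine setIntegral_mono_on (integrable_const _).integrableOn
          (hint.mono_set Set.sdiff_subset) (hBΩ.diff hG) fun ω hω => ?_
        have : ¬ ‖X (t + 1) ω - x‖ < ρ / 2 := fun h => hω.2 (mem_ball_iff_norm.2 h)
        exact pow_le_pow_left₀ (by positivity) (not_lt.1 this) 2
  have hout0 : 0 ≤ μ.real (B \ G) := measureReal_nonneg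
  have hR : 0 < (ρ / 2) ^ 2 := by positivity
  have hq : 0 ≤ (∫ ω in B \ G, ‖X (t + 1) ω - x‖ ^ 2 ∂μ) :=
    integral_nonneg fun ω => by positivity
  refine ⟨by linarith, ?_⟩
  have m1 : μ.real B + μ.real (A \ Xh t ⁻¹' Metric.ball x ρ) = μ.real A :=
    measureReal_inter_add_sdiff (hrun.measurable_Xh t ht measurableSet_ball)
  have m2 : μ.real (B ∩ G) + μ.real (B \ G) = μ.real B := measureReal_inter_add_sdiff hG
  have h3 : μ.real (B \ G) ≤ (∫ ω in A, ‖X t ω - x‖ ^ 2 ∂μ) / (ρ / 2) ^ 2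
      + K * (η * γ ^ 2 + η ^ 2) / (ρ / 2) ^ 2 * s ^ (-(4 / 3) : ℝ) * μ.real A
      - (∫ ω in B ∩ G, ‖X (t + 1) ω - x‖ ^ 2 ∂μ) / (ρ / 2) ^ 2 := by
    have h4 : 0 ≤ 2 / s * (∫ ω in A, ‖X t ω - x‖ ^ 2 ∂μ) := by positivity
    have h5 : μ.real (B \ G) ≤ ((∫ ω in A, ‖X t ω - x‖ ^ 2 ∂μ)
        + K * (η * γ ^ 2 + η ^ 2) * s ^ (-(4 / 3) : ℝ) * μ.real A
        - ∫ ω in B ∩ G, ‖X (t + 1) ω - x‖ ^ 2 ∂μ) / (ρ / 2) ^ 2 := by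
      rw [le_div_iff₀ hR]
      linarith
    refine h5.trans_eq ?_
    ring
  linarith

end Run

/-! ### Conditioning, limits and telescoping -/

section Conclusion

variable {d : ℕ} {Ω : Type*} [MeasurableSpace Ω] {μ : Measure Ω} [IsProbabilityMeasure μ]
  {x : EuclideanSpace ℝ (Fin d)} {ρ : ℝ} {X Xh : ℕ → Ω → EuclideanSpace ℝ (Fin d)}

lemma cond_apply_ge {A S : Set Ω} (hS : MeasurableSet S) (hAS : A ⊆ S) (hS0 : μ S ≠ 0) {c : ℝ}
    (h : c * μ.real S ≤ μ.real A) : ENNReal.ofReal c ≤ μ[A | S] := by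
  rw [cond_apply hS, Set.inter_eq_self_of_subset_right hAS]
  calc ENNReal.ofReal c = (μ S)⁻¹ * (μ S * ENNReal.ofReal c) := by
        rw [← mul_assoc, ENNReal.inv_mul_cancel hS0 (measure_ne_top _ _), one_mul]
    _ ≤ (μ S)⁻¹ * μ A := by
        gcongr
        rw [← ofReal_measureReal (μ := μ) (s := S), ← ofReal_measureReal (μ := μ) (s := A),
          ← ENNReal.ofReal_mul measureReal_nonneg, mul_comm]
        exact ENNReal.ofReal_le_ofReal h

lemma measureReal_iInter_ge {A : ℕ → Set Ω} (hA : ∀ n, MeasurableSet (A n)) (hanti : Antitone A)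
    {c : ℝ} (h : ∀ n, c ≤ μ.real (A n)) : c ≤ μ.real (⋂ n, A n) := by
  have h1 := tendsto_measure_iInter_atTop (μ := μ) (fun n => (hA n).nullMeasurableSet) hanti
    ⟨0, measure_ne_top _ _⟩
  have h2 : Tendsto (fun n => μ.real (A n)) atTop (𝓝 (μ.real (⋂ n, A n))) :=
    (ENNReal.tendsto_toReal (measure_ne_top _ _)).comp h1
  exact ge_of_tendsto' h2 h

lemma sq_dist_integrableOn {Y : Ω → EuclideanSpace ℝ (Fin d)} (hY : Measurable Y) {A : Set Ω}
    (hA : MeasurableSet A) {R : ℝ} (h : ∀ ω ∈ A, Y ω ∈ Metric.ball x R) :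
    IntegrableOn (fun ω => ‖Y ω - x‖ ^ 2) A μ := by
  refine Measure.integrableOn_of_bounded (M := R ^ 2) (measure_ne_top _ _)
    (((hY.sub_const x).norm).pow_const 2).aestronglyMeasurable ?_
  refine (ae_restrict_iff' hA).2 (ae_of_all _ fun ω hω => ?_)
  rw [Real.norm_of_nonneg (by positivity)]
  exact pow_le_pow_left₀ (norm_nonneg _) (mem_ball_iff_norm.1 (h ω hω)).le 2

lemma setIntegral_sq_dist_le {Y : Ω → EuclideanSpace ℝ (Fin d)} {A : Set Ω}
    (hA : MeasurableSet A) (hY : Measurable Y) {R : ℝ} (h : ∀ ω ∈ A, Y ω ∈ Metric.ball x R) :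
    ∫ ω in A, ‖Y ω - x‖ ^ 2 ∂μ ≤ R ^ 2 * μ.real A := by
  calc ∫ ω in A, ‖Y ω - x‖ ^ 2 ∂μ ≤ ∫ _ in A, R ^ 2 ∂μ :=
        setIntegral_mono_on (sq_dist_integrableOn hY hA h) (integrable_const _).integrableOn hA
          fun ω hω => pow_le_pow_left₀ (norm_nonneg _) (mem_ball_iff_norm.1 (h ω hω)).le 2
    _ = R ^ 2 * μ.real A := by rw [setIntegral_const, smul_eq_mul, mul_comm]

end Conclusion

lemma sub_sum_le_of_step {Φ ε : ℕ → ℝ} {q : ℝ} (h : ∀ t, 1 ≤ t → Φ t - ε t * q ≤ Φ (t + 1))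
    (T : ℕ) : Φ 1 - (∑ t ∈ Finset.range T, ε (t + 1)) * q ≤ Φ (T + 1) := by
  induction T with
  | zero => simp
  | succ T ih =>
    rw [Finset.sum_range_succ]
    have := h (T + 1) (by omega)
    linarith

theorem theorem5 {d : ℕ}
    (V : EuclideanSpace ℝ (Fin d) → EuclideanSpace ℝ (Fin d))
    (x : EuclideanSpace ℝ (Fin d))
    (hx : IsIsolatedSolution V x)
    (L : ℝ≥0) (hL : LipschitzNear L V x)
    (hmono : StableNear V x)
    (hJ : RegularJacobian V x)
    (r p σ κ : ℝ) (hr : 0 < r) (hp : 3 < p) (hσ : 0 ≤ σ) (hκ : 0 ≤ κ)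
    (δ : ℝ) (hδ : 0 < δ) (hδ' : δ < 1)
    (W : Set (EuclideanSpace ℝ (Fin d))) (hW : W ∈ 𝓝 x)
    (γ : ℝ) (hγ : 0 < γ) :
    ∃ η₀ : ℝ, 0 < η₀ ∧ ∀ η : ℝ, η₀ ≤ η →
    ∃ b₀ : ℝ, 0 < b₀ ∧ ∀ b : ℝ, b₀ ≤ b →
    ∃ U U' : Set (EuclideanSpace ℝ (Fin d)),
      IsOpen U ∧ x ∈ U ∧ IsOpen U' ∧ x ∈ U' ∧ U' ⊆ W ∧
      ∀ (Ω : Type*) [MeasurableSpace Ω] (μ : Measure Ω) [IsProbabilityMeasure μ]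
        (X Xh Z Zh : ℕ → Ω → EuclideanSpace ℝ (Fin d)),
        IsDSEG V (explorationStep γ b) (updateStep η b) X Xh Z Zh →
        (∀ t, 1 ≤ t → LocalNoise μ x r p σ κ (baseHistory X Xh t) (X t) (Z t)) →
        (∀ t, 1 ≤ t → LocalNoise μ x r p σ κ (leadHistory X Xh t) (Xh t) (Zh t)) →
        μ {ω | X 1 ω ∈ U} ≠ 0 →
        ∃ A : Set Ω, MeasurableSet A ∧
          ENNReal.ofReal (1 - δ) ≤ μ[A | {ω | X 1 ω ∈ U}] ∧
          μ[{ω | ∀ t, 1 ≤ t → X t ω ∈ U'} | A] = 1 ∧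
          (∀ t, 1 ≤ t → Integrable (fun ω => ‖X t ω - x‖ ^ 2) (μ[|A])) ∧
          (fun t : ℕ => ∫ ω, ‖X t ω - x‖ ^ 2 ∂(μ[|A]))
            =O[atTop] (fun t : ℕ => 1 / (t : ℝ) ^ (1 / 3 : ℝ)) := by
  obtain ⟨τ, hτ, ρ₀, hρ₀, hreg₀⟩ := exists_regularOnBall hx.1 hL hmono hJ
  obtain ⟨ρ₁, hρ₁, hρ₁W⟩ := Metric.mem_nhds_iff.1 hW
  set ρ := min ρ₀ (min r ρ₁) with hρdef
  have hρ : 0 < ρ := by positivity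
  have hρr : ρ ≤ r := (min_le_right _ _).trans (min_le_left _ _)
  have hρρ₁ : ρ ≤ ρ₁ := (min_le_right _ _).trans (min_le_right _ _)
  have hρW : Metric.ball x (ρ / 2) ⊆ W :=
    (Metric.ball_subset_ball (by linarith)).trans hρ₁W
  have hreg := hreg₀ ρ hρ (min_le_left _ _)
  -- This threshold makes the contraction at least `2 / (t + b)`.
  refine ⟨1 / (γ * τ ^ 2), by positivity, fun η hη₀ => ?_⟩
  have hη : 0 < η := lt_of_lt_of_le (by positivity) hη₀
  have hrate : 2 ≤ 2 * (η * γ) * τ ^ 2 := by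
    rw [div_le_iff₀ (by positivity)] at hη₀
    linarith
  set K := stepConst L ρ (1 + (σ + κ * ρ) ^ p) * (η * γ ^ 2 + η ^ 2) with hK
  have hK0 : 0 ≤ K :=
    mul_nonneg (stepConst_nonneg L.2 hρ.le (by positivity)) (by positivity)
  set C₁ := K / (ρ / 2) ^ 2 with hC₁
  set C₂ := (4 / ρ * (σ + κ * ρ)) ^ p * γ ^ p with hC₂
  have hC₁0 : 0 ≤ C₁ := by positivity
  have hC₂0 : 0 ≤ C₂ := by positivity
  -- The allowance `δ` is split into thirds: additive step errors, leading escapes, and the initial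
  -- second moment. Adding `1` to the constants keeps the divisors positive.
  obtain ⟨b₁, hb₁, hsum₁⟩ := exists_forall_sum_shift_rpow_le (α := 4 / 3) (ε := δ / 3 / (C₁ + 1))
    (by norm_num) (by positivity)
  obtain ⟨b₂, hb₂, hsum₂⟩ := exists_forall_sum_shift_rpow_le (α := p / 3) (ε := δ / 3 / (C₂ + 1))
    (by linarith) (by positivity)
  refine ⟨max (max b₁ b₂) (max 1 (max (2 * (η * γ) * τ ^ 2) ((4 * γ * L) ^ (3 : ℝ)))),
    by positivity, fun b hb => ?_⟩
  simp only [max_le_iff] at hb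
  obtain ⟨⟨hbb₁, hbb₂⟩, hb1, hbrate, hbL⟩ := hb
  -- Chosen so that `u ^ 2 / (ρ / 2) ^ 2 = δ / 3`, the share of the initial second moment.
  set u := ρ / 2 * Real.sqrt (δ / 3) with hu
  have hu0 : 0 < u := by positivity
  have husq : u ^ 2 = (ρ / 2) ^ 2 * (δ / 3) := by
    rw [hu, mul_pow, Real.sq_sqrt (by positivity)]
  have huρ : u ≤ ρ / 2 := by
    refine mul_le_of_le_one_right (by positivity) ?_
    exact Real.sqrt_le_iff.2 ⟨zero_le_one, by linarith⟩
  have hUsub : Metric.ball x u ⊆ Metric.ball x (ρ / 2) := Metric.ball_subset_ball huρ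
  refine ⟨Metric.ball x u, Metric.ball x (ρ / 2), Metric.isOpen_ball, Metric.mem_ball_self hu0,
    Metric.isOpen_ball, Metric.mem_ball_self (by positivity), hρW, ?_⟩
  intro Ω _ μ _ X Xh Z Zh hrun hN hN' hpos
  have hbγ : ∀ t : ℕ, 1 ≤ t → explorationStep γ b t * (L * ρ) ≤ ρ / 4 := fun t ht => by
    have h1 : 4 * γ * L ≤ ((t : ℝ) + b) ^ (1 / 3 : ℝ) := by
      have : ((4 * γ * L) ^ (3 : ℝ)) ^ (1 / 3 : ℝ) ≤ ((t : ℝ) + b) ^ (1 / 3 : ℝ) :=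
        Real.rpow_le_rpow (by positivity) (hbL.trans (by simp)) (by norm_num)
      rwa [← Real.rpow_mul (by positivity), show (3 : ℝ) * (1 / 3) = 1 by norm_num,
        Real.rpow_one] at this
    have h2 : 0 < ((t : ℝ) + b) ^ (1 / 3 : ℝ) := by positivity
    unfold explorationStep
    rw [div_mul_eq_mul_div, div_le_iff₀ h2]
    have := mul_le_mul_of_nonneg_left h1 hρ.le
    linarith
  have hstep := fun (t : ℕ) (ht : 1 ≤ t) => stayEvent_step hreg hρr (by linarith) hσ hκ hγ.le hη.le
    hb1 (hbγ t ht) hrate hbrate (measurableSet_ball (x := x) (ε := u)) hrun hN hN' ht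
  set S : Set Ω := {ω | X 1 ω ∈ Metric.ball x u} with hS
  have hSm : MeasurableSet S := hrun.measurable_X 1 le_rfl measurableSet_ball
  set E := stayEvent X Xh x ρ (Metric.ball x u)
  set a : ℕ → ℝ := fun t => ∫ ω in E t, ‖X t ω - x‖ ^ 2 ∂μ with ha
  have hEm : ∀ t, 1 ≤ t → MeasurableSet (E t) := fun t ht =>
    (baseHistory_le_leadHistory.trans (leadHistory_le hrun.measurable_X hrun.measurable_Xh)) _
      (measurableSet_stayEvent measurableSet_ball ht)
  have hE1 : E 1 = S := stayEvent_one hUsub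
  have hEball : ∀ t, 1 ≤ t → ∀ ω ∈ E t, X t ω ∈ Metric.ball x (ρ / 2) :=
    fun t ht ω hω => (mem_stayEvent.1 hω).2.1 t ht le_rfl
  have hEanti : Antitone E := antitone_stayEvent
  have hEq : ∀ t, 1 ≤ t → μ.real (E t) ≤ μ.real S := fun t ht => by
    rw [← hE1]; exact measureReal_mono (hEanti ht)
  have ha0 : ∀ t, 0 ≤ a t := fun t => integral_nonneg fun ω => by positivity
  have hq0 : 0 ≤ μ.real S := measureReal_nonneg
  have hstay : ∀ T : ℕ, (1 - δ) * μ.real S ≤ μ.real (E (T + 1)) := fun T => by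
    have h1 := sub_sum_le_of_step (Φ := fun t => μ.real (E t) - a t / (ρ / 2) ^ 2)
      (ε := fun t => C₂ * ((t : ℝ) + b) ^ (-(p / 3)) + C₁ * ((t : ℝ) + b) ^ (-(4 / 3) : ℝ))
      -- The losses are measured against the probability of the start, not against `1`, so the final
      -- bound is relative to `S`.
      (q := μ.real S) (fun t ht => by
        refine le_trans ?_ (hstep t ht).2
        have ht' : 0 < (t : ℝ) + b := by positivity
        refine sub_le_sub_left (mul_le_mul_of_nonneg_left (hEq t ht) (by positivity)) _) T
    simp only [Finset.sum_add_distrib, ← Finset.mul_sum] at h1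
    have h2 : C₁ * ∑ t ∈ Finset.range T, (((t + 1 : ℕ) : ℝ) + b) ^ (-(4 / 3) : ℝ) ≤ δ / 3 := by
      refine (mul_le_mul_of_nonneg_left (hsum₁ b hbb₁ T) hC₁0).trans ?_
      rw [mul_div_assoc', div_le_iff₀ (by positivity)]
      linarith
    have h3 : C₂ * ∑ t ∈ Finset.range T, (((t + 1 : ℕ) : ℝ) + b) ^ (-(p / 3)) ≤ δ / 3 := by
      refine (mul_le_mul_of_nonneg_left (hsum₂ b hbb₂ T) hC₂0).trans ?_
      rw [mul_div_assoc', div_le_iff₀ (by positivity)]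
      linarith
    have h4 : a 1 / (ρ / 2) ^ 2 ≤ δ / 3 * μ.real S := by
      rw [div_le_iff₀ (by positivity)]
      have := setIntegral_sq_dist_le (μ := μ) hSm (hrun.measurable_X 1 le_rfl) (fun ω hω => hω)
      rw [husq] at this
      simp only [ha, hE1]
      linarith
    have h5 := mul_le_mul_of_nonneg_right (add_le_add h3 h2) hq0
    have h6 : 0 ≤ a (T + 1) / (ρ / 2) ^ 2 := div_nonneg (ha0 _) (by positivity)
    rw [hE1] at h1
    linarith
  obtain ⟨M, hM0, hM⟩ := le_mul_rpow_of_recursion (a := a) hb1 hK0 fun t ht => by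
    refine (hstep t ht).1.trans (add_le_add le_rfl ?_)
    refine mul_le_of_le_one_right (by positivity) measureReal_le_one
  set A := ⋂ t, E (t + 1) with hA
  have hAm : MeasurableSet A := MeasurableSet.iInter fun t => hEm _ (by omega)
  have hAE : ∀ t, 1 ≤ t → A ⊆ E t := fun t ht => by
    have := Set.iInter_subset (fun t => E (t + 1)) (t - 1)
    rwa [Nat.sub_add_cancel ht] at this
  have hAreal : (1 - δ) * μ.real S ≤ μ.real A :=
    measureReal_iInter_ge (fun t => hEm _ (by omega)) (fun s t hst => hEanti (by omega)) hstay
  -- Here `δ < 1` and the positive probability of the start make conditioning on `A` meaningful.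
  have hA0 : μ A ≠ 0 := fun h => by
    have h1 : 0 < μ.real S := ENNReal.toReal_pos hpos (measure_ne_top _ _)
    have h2 : μ.real A = 0 := by rw [measureReal_def, h, ENNReal.toReal_zero]
    have h3 : 0 < (1 - δ) * μ.real S := mul_pos (by linarith) h1
    linarith
  have hAint : ∀ t, 1 ≤ t → IntegrableOn (fun ω => ‖X t ω - x‖ ^ 2) A μ := fun t ht =>
    sq_dist_integrableOn (hrun.measurable_X t ht) hAm fun ω hω => hEball t ht ω (hAE t ht hω)
  refine ⟨A, hAm, cond_apply_ge hSm (hE1 ▸ hAE 1 le_rfl) hpos hAreal, ?_, ?_, ?_⟩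
  · have hsub : A ⊆ {ω | ∀ t, 1 ≤ t → X t ω ∈ Metric.ball x (ρ / 2)} :=
      fun ω hω t ht => hEball t ht ω (hAE t ht hω)
    rw [cond_apply hAm, Set.inter_eq_self_of_subset_left hsub, ENNReal.inv_mul_cancel hA0 (measure_ne_top _ _)]
  · exact fun t ht => (hAint t ht).smul_measure (ENNReal.inv_ne_top.2 hA0)
  · refine IsBigO.of_bound ((μ A)⁻¹.toReal * M) ?_
    filter_upwards [eventually_ge_atTop 1] with t ht
    have ht' : (0 : ℝ) < t := by exact_mod_cast ht
    rw [ProbabilityTheory.cond, integral_smul_measure, smul_eq_mul,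
      Real.norm_of_nonneg (mul_nonneg ENNReal.toReal_nonneg
        (integral_nonneg fun ω => by positivity)), Real.norm_of_nonneg (by positivity), mul_assoc]
    refine mul_le_mul_of_nonneg_left ?_ ENNReal.toReal_nonneg
    calc ∫ ω in A, ‖X t ω - x‖ ^ 2 ∂μ ≤ a t :=
          setIntegral_mono_set (sq_dist_integrableOn (hrun.measurable_X t ht) (hEm t ht)
            (hEball t ht)) (ae_of_all _ fun ω => by positivity) (hAE t ht).eventuallyLE
      _ ≤ M * ((t : ℝ) + b) ^ (-(1 / 3) : ℝ) := hM t ht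
      _ ≤ M * (1 / (t : ℝ) ^ (1 / 3 : ℝ)) := by
          rw [one_div ((t : ℝ) ^ (1 / 3 : ℝ)), ← Real.rpow_neg ht'.le]
          exact mul_le_mul_of_nonneg_left
            (Real.rpow_le_rpow_of_nonpos ht' (by linarith) (by norm_num)) hM0
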